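/- Let $k,l\ge 1$ be integers. A finite family $(X_i)_{i\in I}$ of random variables on a probability space satisfies (HD,$k$,$l$) if there are finitely many independent random variables $Y_1,\dots,Y_N$ (with values in arbitrary measurable spaces) and sets $S_i\subseteq\{1,\dots,N\}$, $i\in I$, such that each $X_i$ is almost surely a measurable function of $(Y_j)_{j\in S_i}$, $|S_i|\le k$ for every $i\in I$, and $|\{i\in I: j\in S_i\}|\le l$ for every $1\le j\le N$. A median of a real random variable $Z$ is a real number $m$ with $\mathbb P(Z\le m)\ge \frac12$ and $\mathbb P(Z\ge m)\ge\frac12$. **Theorem.** Let $M$ be a random real symmetric $n\times n$ matrix whose entries satisfy $|M_{ij}|\le 1$ almost surely, and suppose that the family $(M_{ij})_{1\le i\le j\le n}$ of entries on and above the diagonal satisfies (HD,$k$,$l$). Let $\lambda_1(M)\ge\dots\ge\lambda_n(M)$ be the eigenvalues of $M$, counted with multiplicity. Then for every integer $1\le s\le n$, every median $m$ of $\lambda_s(M)$ and every real $t\ge 0$, $$\mathbb P\bigl(|\lambda_s(M)-m|>t\bigr)\le 4\exp\left(-\frac{t^2}{80\,s^2\,k\,l}\right),$$ and the same estimate holds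 for $\lambda_{n-s+1}(M)$: for every median $m'$ of $\lambda_{n-s+1}(M)$ and every real $t\ge 0$, $$\mathbb P\bigl(|\lambda_{n-s+1}(M)-m'|>t\bigr)\le 4\exp\left(-\frac{t^2}{80\,s^2\,k\,l}\right).$$ -/

import Mathlib

open MeasureTheory ProbabilityTheory

universe u v x w

/-- Hypergraph dependence `(HD, k, l)` of a finite family `X` of random variables: there are
independent random variables `Y 0, …, Y (N - 1)`, with values in arbitrary measurable spaces, such
that each `X i` is (almost surely) a measurable function of the subfamily `(Y j)` with `j ∈ S i`,
where every `S i` has at most `k` elements and every `R j = {i | j ∈ S i}` has at most `l`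
elements. -/
def SatisfiesHD {Ω : Type u} [MeasurableSpace Ω] (μ : Measure Ω)
    {ι : Type v} [Fintype ι] {Λ : ι → Type x} [∀ i, MeasurableSpace (Λ i)]
    (X : ∀ i, Ω → Λ i) (k l : ℕ) : Prop :=
  ∃ (N : ℕ) (E : Fin N → Type w) (_ : ∀ j, MeasurableSpace (E j))
    (Y : ∀ j, Ω → E j) (S : ι → Finset (Fin N)) (f : ∀ i, (∀ j : S i, E j) → Λ i),
    (∀ j, Measurable (Y j)) ∧ iIndepFun Y μ ∧
    (∀ i, Measurable (f i)) ∧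
    (∀ i, ∀ᵐ ω ∂μ, X i ω = f i (fun j => Y j ω)) ∧
    (∀ i, (S i).card ≤ k) ∧
    (∀ j, (Finset.univ.filter (fun i => j ∈ S i)).card ≤ l)

/-- `m` is a median of the real random variable `Z`. -/
def IsMedian {Ω : Type*} [MeasurableSpace Ω] (μ : Measure Ω) (Z : Ω → ℝ) (m : ℝ) : Prop :=
  1 / 2 ≤ μ {ω | Z ω ≤ m} ∧ 1 / 2 ≤ μ {ω | m ≤ Z ω}

/-- The `s`-th largest eigenvalue `λ_s(A)`, for `1 ≤ s ≤ n` and counted with multiplicity, of a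
real symmetric `n × n` matrix `A`: `λ_1(A) ≥ … ≥ λ_n(A)`. -/
noncomputable def sortedEigenvalue {n : ℕ} {A : Matrix (Fin n) (Fin n) ℝ} (hA : A.IsHermitian)
    (s : ℕ) (hs : 1 ≤ s ∧ s ≤ n) : ℝ :=
  hA.eigenvalues₀ ⟨s - 1, by rw [Fintype.card_fin]; omega⟩

/-! Given symmetric `A`, `A'`, dimension counting yields a unit vector u in the span of the first s
eigenvectors of `A` and orthogonal to the first s - 1 eigenvectors of `A'`, so λ_s(A) - λ_s(A') ≤
⟨u, (A - A')u⟩. Cauchy–Schwarz bounds |u_q| by √W_q, where W_q is the squared length of the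
projection of e_q onto that span. For entries bounded by 1, the drop of λ_s is thus at most a
weighted Hamming distance on the upper triangle whose weights depend on `A` alone and have square
sum at most 8s² (`exists_weights_sortedEigenvalue_sub_le`).

Such one-sided certificates are what Talagrand's convex distance inequality needs
(`talagrand_convexDist`, with exponent 1/10). Summing the weights of all entries that use Y_j turns
them into weights on the independent variables, at the cost of a factor kl (`sum_sq_sum_filter_le`).
Hence P(λ_s ≤ a) P(λ_s ≥ b) ≤ exp(-(b - a)²/(80 s² kl)), and a median makes one factor at least 1/2
in each tail.

Talagrand's inequality is proved for finite alphabets only; `exists_finite_discretization` reduces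
general Y_j to that case. The eigenvalue λ_{n-s+1} is handled by passing to -M. -/

/-! ### Convex distance and its behaviour under adding a coordinate -/

/-- The vectors dominating the Hamming pattern `(1_{x j ≠ y j})_j` for some `y ∈ A`. -/
def hammingPatterns {N : ℕ} {T : Type*} [DecidableEq T] (A : Set (Fin N → T)) (x : Fin N → T) :
    Set (Fin N → ℝ) :=
  {v | ∃ y ∈ A, ∀ j, (if x j ≠ y j then (1 : ℝ) else 0) ≤ v j}

/-- The squared Talagrand convex distance from `x` to `A` is at most `d`. -/
def ConvexDistSqLE {N : ℕ} {T : Type*} [DecidableEq T] (A : Set (Fin N → T)) (x : Fin N → T)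
    (d : ℝ) : Prop :=
  ∃ v ∈ convexHull ℝ (hammingPatterns A x), ∑ j, v j ^ 2 ≤ d

/-- Prepending a coordinate maps the hull of a section into the hull of the whole set. -/
theorem cons_mem_convexHull_hammingPatterns {N : ℕ} {T : Type*} [DecidableEq T]
    {A : Set (Fin (N + 1) → T)} {t t' : T} {c : ℝ} (hc : (if t ≠ t' then (1 : ℝ) else 0) ≤ c)
    {x : Fin N → T} {v : Fin N → ℝ}
    (hv : v ∈ convexHull ℝ (hammingPatterns {y | (Fin.cons t' y : Fin (N + 1) → T) ∈ A} x)) :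
    (Fin.cons c v : Fin (N + 1) → ℝ) ∈
      convexHull ℝ (hammingPatterns A (Fin.cons t x : Fin (N + 1) → T)) := by
  have hconv : Convex ℝ {w : Fin N → ℝ | (Fin.cons c w : Fin (N + 1) → ℝ) ∈
      convexHull ℝ (hammingPatterns A (Fin.cons t x : Fin (N + 1) → T))} := by
    intro w₁ h₁ w₂ h₂ a b ha hb hab
    have := convex_convexHull ℝ (hammingPatterns A (Fin.cons t x : Fin (N + 1) → T)) h₁ h₂ ha hb hab
    have heq : a • (Fin.cons c w₁ : Fin (N + 1) → ℝ) + b • (Fin.cons c w₂ : Fin (N + 1) → ℝ)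
        = Fin.cons c (a • w₁ + b • w₂) := by
      funext j
      refine Fin.cases ?_ (fun i => ?_) j
      · simp [← add_mul, hab]
      · simp
    rw [heq] at this
    exact this
  refine convexHull_min ?_ hconv hv
  rintro w ⟨y, hy, hyw⟩
  refine subset_convexHull ℝ _ ⟨Fin.cons t' y, hy, fun j => ?_⟩
  refine Fin.cases ?_ (fun i => ?_) j
  · simpa using hc
  · simpa using hyw i

/-- Moving to another section costs one unit in the new coordinate. -/
theorem ConvexDistSqLE.cons_of_section {N : ℕ} {T : Type*} [DecidableEq T]
    {A : Set (Fin (N + 1) → T)} (t t' : T) {x : Fin N → T} {d : ℝ}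
    (h : ConvexDistSqLE {y | (Fin.cons t' y : Fin (N + 1) → T) ∈ A} x d) :
    ConvexDistSqLE A (Fin.cons t x : Fin (N + 1) → T) (1 + d) := by
  obtain ⟨v, hv, hd⟩ := h
  -- The patterns are closed upwards, so the entry 1 is allowed even when `t = t'`.
  refine ⟨Fin.cons 1 v, cons_mem_convexHull_hammingPatterns (t' := t')
    (by split_ifs <;> norm_num) hv, ?_⟩
  simpa [Fin.sum_univ_succ] using hd

/-- Interpolation between the section at `t` and the section at `t'`. -/
theorem ConvexDistSqLE.cons_interpolate {N : ℕ} {T : Type*} [DecidableEq T]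
    {A : Set (Fin (N + 1) → T)} (t t' : T) {x : Fin N → T} {d₁ d₂ a : ℝ}
    (ha0 : 0 ≤ a) (ha1 : a ≤ 1)
    (h₁ : ConvexDistSqLE {y | (Fin.cons t y : Fin (N + 1) → T) ∈ A} x d₁)
    (h₂ : ConvexDistSqLE {y | (Fin.cons t' y : Fin (N + 1) → T) ∈ A} x d₂) :
    ConvexDistSqLE A (Fin.cons t x : Fin (N + 1) → T)
      ((1 - a) ^ 2 + (a * d₁ + (1 - a) * d₂)) := by
  obtain ⟨v, hv, hd₁⟩ := h₁
  obtain ⟨w, hw, hd₂⟩ := h₂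
  -- New coordinate 0 for the section at `t`, 1 for the one at `t'`: the mixture has first
  -- coordinate `1 - a`.
  have hv' := cons_mem_convexHull_hammingPatterns (t := t) (t' := t) (c := 0) (by simp) hv
  have hw' := cons_mem_convexHull_hammingPatterns (t := t) (t' := t') (c := 1)
    (by split_ifs <;> norm_num) hw
  refine ⟨_, convex_convexHull ℝ _ hv' hw' ha0 (sub_nonneg.2 ha1) (by ring), ?_⟩
  have hsum : ∑ j, (a * v j + (1 - a) * w j) ^ 2 ≤ a * d₁ + (1 - a) * d₂ := by
    calc ∑ j, (a * v j + (1 - a) * w j) ^ 2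
        ≤ ∑ j, (a * v j ^ 2 + (1 - a) * w j ^ 2) := by
          refine Finset.sum_le_sum fun j _ => ?_
          nlinarith [mul_nonneg (mul_nonneg ha0 (sub_nonneg.2 ha1)) (sq_nonneg (v j - w j))]
      _ = a * ∑ j, v j ^ 2 + (1 - a) * ∑ j, w j ^ 2 := by
          rw [Finset.sum_add_distrib, Finset.mul_sum, Finset.mul_sum]
      _ ≤ _ := add_le_add (mul_le_mul_of_nonneg_left hd₁ ha0)
          (mul_le_mul_of_nonneg_left hd₂ (sub_nonneg.2 ha1))
  simpa [Fin.sum_univ_succ] using hsum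

/-- A linear functional with nonnegative coefficients separating `x` from `A` bounds the convex
distance from below. -/
theorem ConvexDistSqLE.sq_le {N : ℕ} {T : Type*} [DecidableEq T] {A : Set (Fin N → T)}
    {x : Fin N → T} {d τ C : ℝ} {β : Fin N → ℝ} (h : ConvexDistSqLE A x d)
    (hτ : 0 ≤ τ) (hβ : ∀ j, 0 ≤ β j) (hC : ∑ j, β j ^ 2 ≤ C)
    (hA : ∀ y ∈ A, τ ≤ ∑ j, β j * if x j ≠ y j then (1 : ℝ) else 0) :
    τ ^ 2 ≤ C * d := by
  obtain ⟨v, hv, hd⟩ := h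
  have hsub : convexHull ℝ (hammingPatterns A x) ⊆ {w | τ ≤ ∑ j, β j * w j} := by
    refine convexHull_min ?_ ?_
    · rintro w ⟨y, hy, hyw⟩
      exact (hA y hy).trans (Finset.sum_le_sum fun j _ => mul_le_mul_of_nonneg_left (hyw j) (hβ j))
    · intro w₁ h₁ w₂ h₂ a b ha hb hab
      have : ∑ j, β j * (a • w₁ + b • w₂) j = a * ∑ j, β j * w₁ j + b * ∑ j, β j * w₂ j := by
        rw [Finset.mul_sum, Finset.mul_sum, ← Finset.sum_add_distrib]
        refine Finset.sum_congr rfl fun j _ => ?_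
        simp; ring
      simp only [Set.mem_ofPred_eq] at h₁ h₂ ⊢
      rw [this]
      calc τ = a * τ + b * τ := by rw [← add_mul, hab, one_mul]
        _ ≤ _ := add_le_add (mul_le_mul_of_nonneg_left h₁ ha) (mul_le_mul_of_nonneg_left h₂ hb)
  have h1 : τ ≤ ∑ j, β j * v j := hsub hv
  calc τ ^ 2 ≤ (∑ j, β j * v j) ^ 2 := pow_le_pow_left₀ hτ h1 2
    _ ≤ (∑ j, β j ^ 2) * ∑ j, v j ^ 2 := Finset.sum_mul_sq_le_sq_mul_sq _ _ _
    _ ≤ C * d := mul_le_mul hC hd (Finset.sum_nonneg fun j _ => sq_nonneg _)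
        ((Finset.sum_nonneg fun j _ => sq_nonneg _).trans hC)

/-! ### Talagrand's inequality on finite product spaces -/

/-- The one-dimensional optimisation in the induction for Talagrand's inequality. -/
theorem exp_quadratic_le_two_sub_exp_neg {L : ℝ} (h0 : 0 ≤ L) (h1 : L ≤ 1 / 5) :
    Real.exp ((5 * L) ^ 2 / 10 + (1 - 5 * L) * L) ≤ 2 - Real.exp (-L) := by
  have hx0 : 0 ≤ (5 * L) ^ 2 / 10 + (1 - 5 * L) * L := by nlinarith
  have hx1 : (5 * L) ^ 2 / 10 + (1 - 5 * L) * L ≤ L := by nlinarith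
  set y := (5 * L) ^ 2 / 10 + (1 - 5 * L) * L with hy
  have h2 : Real.exp y ≤ 1 + y + y ^ 2 := by
    have := Real.abs_exp_sub_one_sub_id_le (x := y) (by rw [abs_of_nonneg hx0]; linarith)
    have := (abs_le.1 this).2
    linarith
  have h3 : Real.exp (-L) ≤ 1 - L + L ^ 2 := by
    have := Real.abs_exp_sub_one_sub_id_le (x := -L) (by rw [abs_neg, abs_of_nonneg h0]; linarith)
    have := (abs_le.1 this).2
    nlinarith
  have h4 : y ^ 2 ≤ L ^ 2 := pow_le_pow_left₀ hx0 hx1 2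
  have : y = L - 5 / 2 * L ^ 2 := by rw [hy]; ring
  -- It remains that 1 + L - (5/2)L² + L² ≤ 1 + L - L².
  nlinarith [sq_nonneg L]

/-- Interpolated exponential moments. -/
theorem sum_mul_exp_interpolate_le {ι : Type*} [Fintype ι] {w f g : ι → ℝ} {P Q a c : ℝ}
    (hw : ∀ i, 0 ≤ w i) (hP : 0 < P) (hQ : 0 < Q) (ha0 : 0 ≤ a) (ha1 : a ≤ 1)
    (hf : P * ∑ i, w i * Real.exp (f i) ≤ 1) (hg : Q * ∑ i, w i * Real.exp (g i) ≤ 1) :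
    ∑ i, w i * Real.exp (c + (a * f i + (1 - a) * g i)) ≤
      Real.exp (c - a * Real.log P - (1 - a) * Real.log Q) := by
  have key : ∀ i, w i * Real.exp (c + (a * f i + (1 - a) * g i)) ≤
      Real.exp (c - a * Real.log P - (1 - a) * Real.log Q) *
        (a * (P * (w i * Real.exp (f i))) + (1 - a) * (Q * (w i * Real.exp (g i)))) := by
    intro i
    -- Convexity of exp plays the role of Hölder: shifting by `log P` and `log Q` makes both
    -- exponential sums at most 1.
    have hcv := convexOn_exp.2 (Set.mem_univ (f i + Real.log P)) (Set.mem_univ (g i + Real.log Q))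
      ha0 (sub_nonneg.2 ha1) (by ring)
    simp only [smul_eq_mul] at hcv
    rw [Real.exp_add (f i), Real.exp_add (g i), Real.exp_log hP, Real.exp_log hQ] at hcv
    have hsplit : c + (a * f i + (1 - a) * g i) =
        (c - a * Real.log P - (1 - a) * Real.log Q) +
          (a * (f i + Real.log P) + (1 - a) * (g i + Real.log Q)) := by ring
    rw [hsplit, Real.exp_add]
    calc _ = Real.exp (c - a * Real.log P - (1 - a) * Real.log Q) *
          (w i * Real.exp (a * (f i + Real.log P) + (1 - a) * (g i + Real.log Q))) := by ring
      _ ≤ Real.exp (c - a * Real.log P - (1 - a) * Real.log Q) *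
          (w i * (a * (Real.exp (f i) * P) + (1 - a) * (Real.exp (g i) * Q))) :=
        mul_le_mul_of_nonneg_left (mul_le_mul_of_nonneg_left hcv (hw i)) (Real.exp_pos _).le
      _ = _ := by ring
  refine (Finset.sum_le_sum fun i _ => key i).trans ?_
  rw [← Finset.mul_sum, Finset.sum_add_distrib, ← Finset.mul_sum, ← Finset.mul_sum,
    ← Finset.mul_sum, ← Finset.mul_sum]
  refine mul_le_of_le_one_right (Real.exp_pos _).le ?_
  nlinarith [mul_le_mul_of_nonneg_left hf ha0, mul_le_mul_of_nonneg_left hg (sub_nonneg.2 ha1)]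

open Classical in
/-- **Talagrand's convex distance inequality** on finite product spaces. -/
theorem talagrand_convexDist {T : Type*} [Fintype T] (N : ℕ) (p : Fin N → T → ℝ)
    (hp0 : ∀ j t, 0 ≤ p j t) (hp1 : ∀ j, ∑ t, p j t = 1) (A : Set (Fin N → T))
    (hA : 0 < ∑ x : Fin N → T, if x ∈ A then ∏ j, p j (x j) else 0) :
    ∃ d : (Fin N → T) → ℝ, (∀ x, ConvexDistSqLE A x (d x)) ∧
      (∑ x : Fin N → T, if x ∈ A then ∏ j, p j (x j) else 0) *
        ∑ x : Fin N → T, (∏ j, p j (x j)) * Real.exp (d x / 10) ≤ 1 := by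
  induction N with
  | zero =>
    have hne : A.Nonempty := by
      by_contra h
      rw [Set.not_nonempty_iff_eq_empty] at h
      simp [h] at hA
    obtain ⟨y, hy⟩ := hne
    refine ⟨fun _ => 0, fun x => ⟨0, subset_convexHull ℝ _ ⟨y, hy, fun j => j.elim0⟩, by simp⟩, ?_⟩
    simpa using Finset.card_filter_le {(default : Fin 0 → T)} (· ∈ A)
  | succ N ih =>
    set W : (Fin N → T) → ℝ := fun x => ∏ j, p j.succ (x j) with hW
    have hW0 : ∀ x, 0 ≤ W x := fun x => Finset.prod_nonneg fun j _ => hp0 _ _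
    set Q : T → ℝ := fun t =>
      ∑ x : Fin N → T, if (Fin.cons t x : Fin (N + 1) → T) ∈ A then W x else 0 with hQ
    have hQ0 : ∀ t, 0 ≤ Q t := fun t => Finset.sum_nonneg fun x _ => by
      split_ifs
      exacts [hW0 x, le_rfl]
    have hsplit : ∀ F : (Fin (N + 1) → T) → ℝ,
        ∑ x, F x = ∑ t, ∑ x : Fin N → T, F (Fin.cons t x) := by
      intro F
      rw [← (Fin.consEquiv fun _ => T).sum_comp, Fintype.sum_prod_type]
      rfl
    have hPA : (∑ x : Fin (N + 1) → T, if x ∈ A then ∏ j, p j (x j) else 0) =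
        ∑ t, p 0 t * Q t := by
      rw [hsplit]
      refine Finset.sum_congr rfl fun t _ => ?_
      rw [hQ, Finset.mul_sum]
      refine Finset.sum_congr rfl fun x _ => ?_
      simp [Fin.prod_univ_succ, hW]
    rw [hPA] at hA ⊢
    have hTne : Nonempty T := by
      by_contra h
      rw [not_nonempty_iff] at h
      simp at hA
    -- Every section is compared with a heaviest one.
    obtain ⟨t₀, ht₀⟩ := Finite.exists_max Q
    have hq : 0 < Q t₀ := by
      by_contra h
      have : ∑ t, p 0 t * Q t ≤ 0 := Finset.sum_nonpos fun t _ =>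
        mul_nonpos_of_nonneg_of_nonpos (hp0 0 t) ((ht₀ t).trans (not_lt.1 h))
      linarith
    obtain ⟨d₀, hd₀, hs₀⟩ := ih (fun j => p j.succ) (fun j t => hp0 _ _) (fun j => hp1 _)
      {x | (Fin.cons t₀ x : Fin (N + 1) → T) ∈ A} hq
    change Q t₀ * ∑ x, W x * Real.exp (d₀ x / 10) ≤ 1 at hs₀
    -- The bound is affine in `Q t`, so it can be averaged over `t` at the end.
    have step : ∀ t, ∃ d : (Fin N → T) → ℝ,
        (∀ x, ConvexDistSqLE A (Fin.cons t x : Fin (N + 1) → T) (d x)) ∧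
        Q t₀ * ∑ x, W x * Real.exp (d x / 10) ≤ 2 - Q t / Q t₀ := by
      intro t
      -- The optimal interpolation parameter is `1 - 5 * L` with `L = log (Q t₀ / Q t)`; it is
      -- nonnegative exactly for `L ≤ 1 / 5`. Lighter sections use only the section at `t₀`.
      by_cases hr : Q t ≤ Real.exp (-(1 / 5)) * Q t₀
      · refine ⟨fun x => 1 + d₀ x, fun x => (hd₀ x).cons_of_section t t₀, ?_⟩
        have h1 : ∑ x, W x * Real.exp ((1 + d₀ x) / 10) =
            Real.exp (1 / 10) * ∑ x, W x * Real.exp (d₀ x / 10) := by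
          rw [Finset.mul_sum]
          refine Finset.sum_congr rfl fun x _ => ?_
          rw [add_div, Real.exp_add]; ring
        have h2 : Q t / Q t₀ ≤ Real.exp (-(1 / 5)) := (div_le_iff₀ hq).2 hr
        have h3 : Real.exp (1 / 10) ≤ 2 - Real.exp (-(1 / 5)) := by
          have := exp_quadratic_le_two_sub_exp_neg (L := 1 / 5) (by norm_num) le_rfl
          norm_num at this ⊢
          exact this
        rw [h1]
        calc _ = Real.exp (1 / 10) * (Q t₀ * ∑ x, W x * Real.exp (d₀ x / 10)) := by ring
          _ ≤ Real.exp (1 / 10) * 1 := mul_le_mul_of_nonneg_left hs₀ (Real.exp_pos _).le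
          _ ≤ _ := by linarith
      · push Not at hr
        have hqt : 0 < Q t := lt_of_le_of_lt (by positivity) hr
        obtain ⟨d₁, hd₁, hs₁⟩ := ih (fun j => p j.succ) (fun j t => hp0 _ _) (fun j => hp1 _)
          {x | (Fin.cons t x : Fin (N + 1) → T) ∈ A} hqt
        change Q t * ∑ x, W x * Real.exp (d₁ x / 10) ≤ 1 at hs₁
        set L := Real.log (Q t₀) - Real.log (Q t) with hL
        have hL0 : 0 ≤ L := sub_nonneg.2 (Real.log_le_log hqt (ht₀ t))
        have hL1 : L ≤ 1 / 5 := by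
          have := Real.log_le_log (by positivity) hr.le
          rw [Real.log_mul (Real.exp_pos _).ne' hq.ne', Real.log_exp] at this
          linarith
        have hexpL : Real.exp (-L) = Q t / Q t₀ := by
          rw [hL, neg_sub, Real.exp_sub, Real.exp_log hq, Real.exp_log hqt]
        -- The choice `a = 1 - 5 * L` minimises (1 - a)²/10 + aL.
        refine ⟨fun x => (1 - (1 - 5 * L)) ^ 2 +
            ((1 - 5 * L) * d₁ x + (1 - (1 - 5 * L)) * d₀ x),
          fun x => ConvexDistSqLE.cons_interpolate t t₀ (by linarith) (by linarith)
            (hd₁ x) (hd₀ x), ?_⟩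
        have hint := sum_mul_exp_interpolate_le (w := W) (f := fun x => d₁ x / 10)
          (g := fun x => d₀ x / 10) (a := 1 - 5 * L) (c := (5 * L) ^ 2 / 10) hW0 hqt hq
          (by linarith) (by linarith) hs₁ hs₀
        have h1 : ∑ x, W x * Real.exp (((1 - (1 - 5 * L)) ^ 2 +
            ((1 - 5 * L) * d₁ x + (1 - (1 - 5 * L)) * d₀ x)) / 10) ≤
            Real.exp ((5 * L) ^ 2 / 10 + (1 - 5 * L) * L) * (Q t₀)⁻¹ := by
          refine (le_of_eq ?_).trans (hint.trans (le_of_eq ?_))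
          · refine Finset.sum_congr rfl fun x _ => ?_
            congr 2
            ring
          · rw [← Real.exp_log (inv_pos.2 hq), ← Real.exp_add, Real.log_inv, hL]
            congr 1
            ring
        calc _ ≤ Q t₀ * (Real.exp ((5 * L) ^ 2 / 10 + (1 - 5 * L) * L) * (Q t₀)⁻¹) :=
              mul_le_mul_of_nonneg_left h1 hq.le
          _ = Real.exp ((5 * L) ^ 2 / 10 + (1 - 5 * L) * L) := by field_simp
          _ ≤ 2 - Q t / Q t₀ := hexpL ▸ exp_quadratic_le_two_sub_exp_neg hL0 hL1
    choose d hd hds using step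
    refine ⟨fun x => d (x 0) (Fin.tail x), fun x => ?_, ?_⟩
    · simpa [Fin.cons_self_tail] using hd (x 0) (Fin.tail x)
    · set S := ∑ t, p 0 t * Q t with hS
      have h1 : Q t₀ * ∑ x : Fin (N + 1) → T, (∏ j, p j (x j)) *
          Real.exp (d (x 0) (Fin.tail x) / 10) ≤ 2 - S / Q t₀ := by
        rw [hsplit, Finset.mul_sum]
        calc _ = ∑ t, p 0 t * (Q t₀ * ∑ x, W x * Real.exp (d t x / 10)) := by
              refine Finset.sum_congr rfl fun t _ => ?_
              simp only [Finset.mul_sum]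
              refine Finset.sum_congr rfl fun x _ => ?_
              simp [Fin.prod_univ_succ, hW]
              ring
          _ ≤ ∑ t, p 0 t * (2 - Q t / Q t₀) :=
              Finset.sum_le_sum fun t _ => mul_le_mul_of_nonneg_left (hds t) (hp0 0 t)
          _ = 2 - S / Q t₀ := by
              simp only [mul_sub, Finset.sum_sub_distrib, ← Finset.sum_mul, hp1, one_mul, hS,
                Finset.sum_div, mul_div_assoc]
      set Z := ∑ x : Fin (N + 1) → T, (∏ j, p j (x j)) *
          Real.exp (d (x 0) (Fin.tail x) / 10) with hZ
      have h2 : S / Q t₀ * (Q t₀ * Z) ≤ S / Q t₀ * (2 - S / Q t₀) :=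
        mul_le_mul_of_nonneg_left h1 (by positivity)
      have h3 : S / Q t₀ * (Q t₀ * Z) = S * Z := by field_simp
      -- With r = S / Q t₀ this is r(2 - r) ≤ 1.
      nlinarith [sq_nonneg (S / Q t₀ - 1)]

open Classical in
/-- Two-set form of Talagrand's inequality on finite product spaces. -/
theorem talagrand_two_sets {T : Type*} [Fintype T] (N : ℕ) (p : Fin N → T → ℝ)
    (hp0 : ∀ j t, 0 ≤ p j t) (hp1 : ∀ j, ∑ t, p j t = 1) (A B : Set (Fin N → T)) {τ C : ℝ}
    (hτ : 0 ≤ τ) (hC : 0 < C)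
    (hsep : ∀ x ∈ B, ∃ β : Fin N → ℝ, (∀ j, 0 ≤ β j) ∧ ∑ j, β j ^ 2 ≤ C ∧
      ∀ y ∈ A, τ ≤ ∑ j, β j * if x j ≠ y j then (1 : ℝ) else 0) :
    (∑ x : Fin N → T, if x ∈ A then ∏ j, p j (x j) else 0) *
      (∑ x : Fin N → T, if x ∈ B then ∏ j, p j (x j) else 0) ≤
      Real.exp (-(τ ^ 2 / (10 * C))) := by
  set PA := ∑ x : Fin N → T, if x ∈ A then ∏ j, p j (x j) else 0 with hPA
  have hw : ∀ x : Fin N → T, 0 ≤ ∏ j, p j (x j) :=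
    fun x => Finset.prod_nonneg fun j _ => hp0 _ _
  have hPA0 : 0 ≤ PA := Finset.sum_nonneg fun x _ => by
    split_ifs
    exacts [hw x, le_rfl]
  rcases hPA0.eq_or_lt with h0 | hpos
  · rw [← h0, zero_mul]
    exact (Real.exp_pos _).le
  obtain ⟨d, hd, hsum⟩ := talagrand_convexDist N p hp0 hp1 A hpos
  have hB : (∑ x : Fin N → T, if x ∈ B then ∏ j, p j (x j) else 0) *
      Real.exp (τ ^ 2 / (10 * C)) ≤
      ∑ x : Fin N → T, (∏ j, p j (x j)) * Real.exp (d x / 10) := by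
    rw [Finset.sum_mul]
    refine Finset.sum_le_sum fun x _ => ?_
    split_ifs with hx
    · obtain ⟨β, hβ, hβC, hβA⟩ := hsep x hx
      have h1 := (hd x).sq_le hτ hβ hβC hβA
      refine mul_le_mul_of_nonneg_left (Real.exp_le_exp.2 ?_) (hw x)
      rw [div_le_div_iff₀ (by positivity) (by norm_num)]
      nlinarith
    · rw [zero_mul]
      exact mul_nonneg (hw x) (Real.exp_pos _).le
  rw [Real.exp_neg, ← one_div, le_div_iff₀ (Real.exp_pos _), mul_assoc]
  exact (mul_le_mul_of_nonneg_left hB hPA0).trans hsum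

/-! ### Independent finite-valued variables and hypergraph families -/

open Classical in
/-- The law of a vector of independent finite-valued random variables. -/
theorem iIndepFun.measureReal_mem_eq_sum {Ω : Type*} [MeasurableSpace Ω] {μ : Measure Ω}
    [IsProbabilityMeasure μ] {N : ℕ} {T : Type*} [Fintype T] [MeasurableSpace T]
    [DiscreteMeasurableSpace T] {Z : Fin N → Ω → T} (hZ : ∀ j, Measurable (Z j))
    (hind : iIndepFun Z μ) (A : Set (Fin N → T)) :
    μ.real {ω | (fun j => Z j ω) ∈ A} =
      ∑ x : Fin N → T, if x ∈ A then ∏ j, μ.real (Z j ⁻¹' {x j}) else 0 := by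
  have hZv : Measurable fun ω j => Z j ω := measurable_pi_lambda _ hZ
  have h1 : μ.real {ω | (fun j => Z j ω) ∈ A} =
      ∑ x ∈ Finset.univ.filter (· ∈ A), μ.real ((fun ω j => Z j ω) ⁻¹' {x}) := by
    rw [← measureReal_biUnion_finset]
    · congr 1
      ext ω
      simp
    · intro x _ y _ hxy
      exact Disjoint.preimage _ (by simpa using hxy)
    · exact fun x _ => hZv (measurableSet_singleton x)
  rw [h1, Finset.sum_filter]
  refine Finset.sum_congr rfl fun x _ => ?_
  split_ifs with hx
  · have h2 : (fun ω j => Z j ω) ⁻¹' {x} = ⋂ j ∈ Finset.univ, Z j ⁻¹' {x j} := by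
      ext ω
      simp [funext_iff]
    rw [h2, measureReal_def, hind.measure_inter_preimage_eq_mul Finset.univ
      fun j _ => measurableSet_singleton _, ENNReal.toReal_prod]
    rfl
  · rfl

/-- Two-set form of Talagrand's inequality for independent finite-valued random variables. -/
theorem iIndepFun.talagrand_two_sets {Ω : Type*} [MeasurableSpace Ω] {μ : Measure Ω}
    [IsProbabilityMeasure μ] {N : ℕ} {T : Type*} [Fintype T] [DecidableEq T] [MeasurableSpace T]
    [DiscreteMeasurableSpace T] {Z : Fin N → Ω → T} (hZ : ∀ j, Measurable (Z j))
    (hind : iIndepFun Z μ) (A B : Set (Fin N → T)) {τ C : ℝ} (hτ : 0 ≤ τ) (hC : 0 < C)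
    (hsep : ∀ x ∈ B, ∃ β : Fin N → ℝ, (∀ j, 0 ≤ β j) ∧ ∑ j, β j ^ 2 ≤ C ∧
      ∀ y ∈ A, τ ≤ ∑ j, β j * if x j ≠ y j then (1 : ℝ) else 0) :
    μ.real {ω | (fun j => Z j ω) ∈ A} * μ.real {ω | (fun j => Z j ω) ∈ B} ≤
      Real.exp (-(τ ^ 2 / (10 * C))) := by
  classical
  rw [iIndepFun.measureReal_mem_eq_sum hZ hind, iIndepFun.measureReal_mem_eq_sum hZ hind]
  refine _root_.talagrand_two_sets N (fun j t => μ.real (Z j ⁻¹' {t}))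
    (fun _ _ => measureReal_nonneg) (fun j => ?_) A B hτ hC fun x hx => ?_
  · rw [← measureReal_biUnion_finset]
    · have : (⋃ t ∈ (Finset.univ : Finset T), Z j ⁻¹' {t}) = Set.univ := by
        ext ω
        simp
      rw [this, probReal_univ]
    · intro x _ y _ hxy
      exact Disjoint.preimage _ (by simpa using hxy)
    · exact fun x _ => hZ j (measurableSet_singleton x)
  · obtain ⟨β, h1, h2, h3⟩ := hsep x hx
    refine ⟨β, h1, h2, fun y hy => (h3 y hy).trans (le_of_eq ?_)⟩
    refine Finset.sum_congr rfl fun j _ => ?_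
    congr 1
    split_ifs <;> rfl

/-- The incidence bound transferring weights on a hypergraph's family to its ground variables. -/
theorem sum_sq_sum_filter_le {ι κ : Type*} [Fintype ι] [Fintype κ] [DecidableEq κ] {k l : ℕ}
    (S : ι → Finset κ) (hS : ∀ i, (S i).card ≤ k)
    (hR : ∀ j, (Finset.univ.filter fun i => j ∈ S i).card ≤ l) (α : ι → ℝ) :
    ∑ j, (∑ i with j ∈ S i, α i) ^ 2 ≤ k * l * ∑ i, α i ^ 2 := by
  calc ∑ j, (∑ i with j ∈ S i, α i) ^ 2
      ≤ ∑ j, (l : ℝ) * ∑ i with j ∈ S i, α i ^ 2 := by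
        -- Cauchy–Schwarz over at most `l` indices; afterwards each `i` is counted once for every
        -- element of `S i`, at most `k` times.
        refine Finset.sum_le_sum fun j _ => sq_sum_le_card_mul_sum_sq.trans ?_
        exact mul_le_mul_of_nonneg_right (by exact_mod_cast hR j)
          (Finset.sum_nonneg fun i _ => sq_nonneg _)
    _ = l * ∑ i, (S i).card * α i ^ 2 := by
        rw [← Finset.mul_sum]
        congr 1
        simp_rw [Finset.sum_filter]
        rw [Finset.sum_comm]
        refine Finset.sum_congr rfl fun i _ => ?_
        rw [← Finset.sum_filter, Finset.sum_const, nsmul_eq_mul]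
        simp
    _ ≤ l * ∑ i, (k : ℝ) * α i ^ 2 := by
        refine mul_le_mul_of_nonneg_left (Finset.sum_le_sum fun i _ => ?_) (Nat.cast_nonneg l)
        exact mul_le_mul_of_nonneg_right (by exact_mod_cast hS i) (sq_nonneg _)
    _ = _ := by rw [← Finset.mul_sum]; ring

/-- Two-set Talagrand inequality for families that are functions of independent finite-valued
random variables along a hypergraph. -/
theorem iIndepFun.talagrand_hypergraph {Ω : Type*} [MeasurableSpace Ω] {μ : Measure Ω}
    [IsProbabilityMeasure μ] {N : ℕ} {T : Type*} [Fintype T] [MeasurableSpace T]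
    [DiscreteMeasurableSpace T] {Z : Fin N → Ω → T} (hZ : ∀ j, Measurable (Z j))
    (hind : iIndepFun Z μ) {ι Λ : Type*} [Fintype ι] [DecidableEq Λ] {k l : ℕ}
    (hk : 1 ≤ k) (hl : 1 ≤ l)
    (S : ι → Finset (Fin N)) (hS : ∀ i, (S i).card ≤ k)
    (hR : ∀ j, (Finset.univ.filter fun i => j ∈ S i).card ≤ l)
    (h : ∀ i, (∀ _ : S i, T) → Λ) (A B : Set (ι → Λ)) {τ C : ℝ} (hτ : 0 ≤ τ) (hC : 0 < C)
    (hsep : ∀ x ∈ B, ∃ α : ι → ℝ, (∀ i, 0 ≤ α i) ∧ ∑ i, α i ^ 2 ≤ C ∧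
      ∀ y ∈ A, τ ≤ ∑ i, α i * if x i ≠ y i then (1 : ℝ) else 0) :
    μ.real {ω | (fun i => h i fun j => Z j ω) ∈ A} *
      μ.real {ω | (fun i => h i fun j => Z j ω) ∈ B} ≤
      Real.exp (-(τ ^ 2 / (10 * (k * l * C)))) := by
  classical
  have hk' : (0 : ℝ) < k := by exact_mod_cast hk
  have hl' : (0 : ℝ) < l := by exact_mod_cast hl
  refine iIndepFun.talagrand_two_sets hZ hind
    {z | (fun i => h i fun j => z j) ∈ A} {z | (fun i => h i fun j => z j) ∈ B} hτ
    (by positivity) fun z hz => ?_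
  obtain ⟨α, hα, hαC, hαA⟩ := hsep _ hz
  refine ⟨fun j => ∑ i with j ∈ S i, α i, fun j => Finset.sum_nonneg fun i _ => hα i,
    (sum_sq_sum_filter_le S hS hR α).trans (by gcongr), fun z' hz' => ?_⟩
  refine (hαA _ hz').trans ?_
  calc ∑ i, α i * (if (h i fun j => z j) ≠ (h i fun j => z' j) then (1 : ℝ) else 0)
      ≤ ∑ i, α i * ∑ j ∈ S i, if z j ≠ z' j then (1 : ℝ) else 0 := by
        refine Finset.sum_le_sum fun i _ => mul_le_mul_of_nonneg_left ?_ (hα i)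
        have hnn : ∀ j ∈ S i, 0 ≤ if z j ≠ z' j then (1 : ℝ) else 0 := fun j _ => by
          split_ifs <;> norm_num
        split_ifs with hne
        -- A changed value of `h i` forces a change in some coordinate of `S i`.
        · have : ∃ j ∈ S i, z j ≠ z' j := by
            by_contra hcon
            push Not at hcon
            exact hne (congrArg (h i) (funext fun j => hcon j j.2))
          obtain ⟨j, hj, hzj⟩ := this
          refine le_trans ?_ (Finset.single_le_sum hnn hj)
          simp [hzj]
        · exact Finset.sum_nonneg hnn
    _ = ∑ j, (∑ i with j ∈ S i, α i) * if z j ≠ z' j then (1 : ℝ) else 0 := by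
        simp_rw [Finset.sum_mul, Finset.mul_sum, Finset.sum_filter]
        rw [Finset.sum_comm]
        refine Finset.sum_congr rfl fun i _ => ?_
        rw [← Finset.sum_filter]
        exact Finset.sum_congr (by ext; simp) fun _ _ => rfl

/-! ### Reduction to finite alphabets -/

/-- Sets of vectors that are determined by finite measurable discretizations of the coordinates. -/
def finitelyDeterminedSets {J : Type*} (E : J → Type*) [∀ j, MeasurableSpace (E j)]
    (S : Finset J) : Set (Set (∀ j : S, E j)) :=
  {U | ∃ (m : ℕ) (π : ∀ j, E j → Fin m), (∀ j, Measurable (π j)) ∧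
    ∃ H : Set (S → Fin m), U = (fun (y : ∀ j : S, E j) (j : S) => π j (y j)) ⁻¹' H}

/-- Complements keep the discretization; for unions, the product of two discretizations refines
both. Being an algebra that generates the product σ-algebra makes these sets dense in measure. -/
theorem isSetAlgebra_finitelyDeterminedSets {J : Type*} (E : J → Type*)
    [∀ j, MeasurableSpace (E j)] (S : Finset J) : IsSetAlgebra (finitelyDeterminedSets E S) where
  empty_mem := ⟨1, fun _ _ => 0, fun _ => measurable_const, ∅, by simp⟩
  compl_mem := by
    rintro _ ⟨m, π, hπ, H, rfl⟩
    exact ⟨m, π, hπ, Hᶜ, rfl⟩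
  union_mem := by
    rintro _ _ ⟨m, π, hπ, H, rfl⟩ ⟨m', π', hπ', H', rfl⟩
    refine ⟨m * m', fun j e => finProdFinEquiv (π j e, π' j e),
      fun j => (measurable_of_countable finProdFinEquiv).comp ((hπ j).prodMk (hπ' j)),
      {z | (fun j => (finProdFinEquiv.symm (z j)).1) ∈ H ∨
        (fun j => (finProdFinEquiv.symm (z j)).2) ∈ H'}, ?_⟩
    ext y
    simp only [Set.mem_union, Set.mem_preimage, Set.mem_ofPred_eq, Equiv.symm_apply_apply]

theorem measurableSet_of_mem_finitelyDeterminedSets {J : Type*} {E : J → Type*}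
    [∀ j, MeasurableSpace (E j)] {S : Finset J} {U : Set (∀ j : S, E j)}
    (hU : U ∈ finitelyDeterminedSets E S) : MeasurableSet U := by
  obtain ⟨m, π, hπ, H, rfl⟩ := hU
  have hm : Measurable fun (y : ∀ j : S, E j) (j : S) => π j (y j) :=
    measurable_pi_lambda _ fun j => (hπ j).comp (measurable_pi_apply j)
  exact hm (Set.toFinite H).measurableSet

theorem generateFrom_finitelyDeterminedSets {J : Type*} (E : J → Type*)
    [∀ j, MeasurableSpace (E j)] (S : Finset J) :
    (MeasurableSpace.pi : MeasurableSpace (∀ j : S, E j)) =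
      MeasurableSpace.generateFrom (finitelyDeterminedSets E S) := by
  classical
  apply le_antisymm
  · refine iSup_le fun j => ?_
    rintro _ ⟨U, hU, rfl⟩
    refine MeasurableSpace.measurableSet_generateFrom ?_
    -- A two-valued indicator suffices in coordinate `j`; the empty set fills the other coordinates,
    -- where a map is still required.
    let V : ∀ i, Set (E i) := Function.update (fun _ => ∅) (j : J) U
    have hVj : V j = U := Function.update_self ..
    have hV : ∀ i, MeasurableSet (V i) := by
      intro i
      by_cases h : i = j
      · subst h
        rwa [hVj]
      · rw [show V i = ∅ from Function.update_of_ne h ..]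
        exact MeasurableSet.empty
    refine ⟨2, fun i e => if e ∈ V i then 1 else 0,
      fun i => Measurable.ite (hV i) measurable_const measurable_const, {z | z j = 1}, ?_⟩
    ext y
    simp [hVj]
  · exact MeasurableSpace.generateFrom_le fun U hU =>
      measurableSet_of_mem_finitelyDeterminedSets hU

/-- Bounded functions of coordinates `j ∈ S i` are approximated in probability by functions of
finite discretizations of these coordinates. -/
theorem exists_finite_discretization {Ω : Type*} [MeasurableSpace Ω] {μ : Measure Ω}
    [IsProbabilityMeasure μ] {ι : Type v} [Fintype ι] {N : ℕ} {E : Fin N → Type*}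
    [∀ j, MeasurableSpace (E j)] {Y : ∀ j, Ω → E j} (hY : ∀ j, Measurable (Y j))
    {S : ι → Finset (Fin N)} {f : ∀ i, (∀ j : S i, E j) → ℝ} (hf : ∀ i, Measurable (f i))
    {X : ι → Ω → ℝ} (hX : ∀ i, ∀ᵐ ω ∂μ, X i ω = f i fun j => Y j ω)
    (hb : ∀ i, ∀ᵐ ω ∂μ, |X i ω| ≤ 1) {ε : ℝ} (hε : 0 < ε) :
    ∃ (T : Type v) (_ : Fintype T) (_ : MeasurableSpace T) (_ : DiscreteMeasurableSpace T)
      (π : ∀ j, E j → T) (h : ∀ i, (S i → T) → ℝ) (Bad : Set Ω),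
      (∀ j, Measurable (π j)) ∧ (∀ i z, |h i z| ≤ 1) ∧ μ.real Bad ≤ ε ∧
      ∀ ω ∉ Bad, ∀ i, |X i ω - h i fun j => π j (Y j ω)| ≤ ε := by
  classical
  obtain ⟨K', hK'⟩ := exists_nat_one_div_lt hε
  set K : ℕ := K' + 1 with hK
  have hKpos : (0 : ℝ) < K := by positivity
  have hKε : 1 / (K : ℝ) < ε := by simpa [hK] using hK'
  -- All values that ⌊K f⌋ can take when |f| ≤ 1. Each level set is approximated up to measure `δ`,
  -- small enough for a union bound over `ι × I`.
  set I := {c : ℤ // c ∈ Finset.Icc (-(K : ℤ)) K}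
  set δ : ℝ := ε / (Fintype.card (ι × I) + 1) with hδ
  have hδ0 : 0 < δ := by positivity
  have happ : ∀ a : ι × I, ∃ (m : ℕ) (π : ∀ j, E j → Fin m), (∀ j, Measurable (π j)) ∧
      ∃ H : Set (S a.1 → Fin m),
        μ.real {ω | ¬ (⌊K * f a.1 (fun j => Y j ω)⌋ = a.2.1 ↔
          (fun j : S a.1 => π j (Y j ω)) ∈ H)} ≤ δ := by
    intro a
    have hYm : Measurable fun ω (j : S a.1) => Y j ω := measurable_pi_lambda _ fun j => hY j
    have hU : MeasurableSet {y | ⌊K * f a.1 y⌋ = a.2.1} :=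
      (Int.measurable_floor.comp ((hf a.1).const_mul _)) (measurableSet_singleton _)
    obtain ⟨_, ⟨m, π, hπ, H, rfl⟩, hlt⟩ :=
      (Measure.MeasureDense.of_generateFrom_isSetAlgebra_finite
        (μ := μ.map fun ω (j : S a.1) => Y j ω)
        (isSetAlgebra_finitelyDeterminedSets E (S a.1))
        (generateFrom_finitelyDeterminedSets E (S a.1))).approx _ hU (measure_ne_top _ _) δ hδ0
    refine ⟨m, π, hπ, H, ?_⟩
    have hHm : MeasurableSet
        ((fun (y : ∀ j : S a.1, E j) (j : S a.1) => π j (y j)) ⁻¹' H) :=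
      measurableSet_of_mem_finitelyDeterminedSets ⟨m, π, hπ, H, rfl⟩
    rw [Measure.map_apply hYm (hU.symmDiff hHm)] at hlt
    refine ENNReal.toReal_le_of_le_ofReal hδ0.le (le_trans (measure_mono fun ω hω => ?_) hlt.le)
    simp only [Set.mem_preimage, Set.mem_symmDiff, Set.mem_ofPred_eq] at hω ⊢
    tauto
  choose m π hπ H hH using happ
  set Bad : Set Ω := {ω | ¬ ∀ i, X i ω = f i (fun j => Y j ω) ∧ |X i ω| ≤ 1} ∪
    ⋃ a ∈ (Finset.univ : Finset (ι × I)), {ω | ¬ (⌊K * f a.1 (fun j => Y j ω)⌋ = a.2.1 ↔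
      (fun j : S a.1 => π a j (Y j ω)) ∈ H a)} with hBad
  -- A single alphabet records all discretizations at once. The default 0 keeps `h` bounded by 1 at
  -- every point, also where no level set matches.
  refine ⟨∀ a, Fin (m a), inferInstance, inferInstance, inferInstance, fun j e a => π a j e,
    fun i z => if hz : ∃ c : I, (fun j => z j (i, c)) ∈ H (i, c) then (hz.choose.1 : ℝ) / K else 0,
    Bad, fun j => measurable_pi_lambda _ fun a => hπ a j, fun i z => ?_, ?_, ?_⟩
  · dsimp only
    split_ifs with hz
    · have hc := Finset.mem_Icc.1 hz.choose.2
      have h1 : -(K : ℝ) ≤ (hz.choose.1 : ℝ) := by exact_mod_cast hc.1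
      have h2 : (hz.choose.1 : ℝ) ≤ K := by exact_mod_cast hc.2
      rw [abs_div, abs_of_pos hKpos, div_le_one hKpos]
      exact abs_le.2 ⟨h1, h2⟩
    · simp
  · have h0 : μ.real {ω | ¬ ∀ i, X i ω = f i (fun j => Y j ω) ∧ |X i ω| ≤ 1} = 0 := by
      have : ∀ᵐ ω ∂μ, ∀ i, X i ω = f i (fun j => Y j ω) ∧ |X i ω| ≤ 1 :=
        ae_all_iff.2 fun i => (hX i).and (hb i)
      rw [measureReal_def, ae_iff.1 this, ENNReal.toReal_zero]
    calc μ.real Bad ≤ 0 + ∑ a : ι × I, δ := by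
          refine (measureReal_union_le _ _).trans (add_le_add h0.le ?_)
          exact (measureReal_biUnion_finset_le _ _).trans (Finset.sum_le_sum fun a _ => hH a)
      _ = Fintype.card (ι × I) * (ε / (Fintype.card (ι × I) + 1)) := by
          rw [zero_add, Finset.sum_const, nsmul_eq_mul, Finset.card_univ]
      _ ≤ ε := by
          rw [mul_div_assoc', div_le_iff₀ (by positivity)]
          nlinarith
  · intro ω hω i
    simp only [hBad, Set.mem_union, Set.mem_ofPred_eq, Set.mem_iUnion, not_or, not_not,
      not_exists, Finset.mem_univ] at hω
    obtain ⟨hfX, hU⟩ := hω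
    replace hU := fun a => hU a trivial
    obtain ⟨hfi, hbi⟩ := hfX i
    have hbi' := abs_le.1 (hfi ▸ hbi)
    set y := f i (fun j => Y j ω) with hy
    have hfl : ⌊K * y⌋ ∈ Finset.Icc (-(K : ℤ)) K := by
      rw [Finset.mem_Icc]
      constructor
      · rw [Int.le_floor]
        push_cast
        nlinarith
      · rw [← Int.lt_add_one_iff, Int.floor_lt]
        push_cast
        nlinarith
    have hz : ∃ c : I, (fun j : S i => π (i, c) j (Y j ω)) ∈ H (i, c) :=
      ⟨⟨_, hfl⟩, (hU (i, ⟨_, hfl⟩)).1 rfl⟩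
    -- Off `Bad` only the true floor can match, so the arbitrary choice returns it.
    have hzc : ⌊K * y⌋ = hz.choose.1 := (hU (i, hz.choose)).2 hz.choose_spec
    have hval : |y - (hz.choose.1 : ℝ) / K| ≤ ε := by
      rw [← hzc]
      have h1 := Int.floor_le (K * y)
      have h2 := Int.lt_floor_add_one (K * y)
      have h3 : y - (⌊K * y⌋ : ℝ) / K = (K * y - ⌊K * y⌋) / K := by field_simp
      rw [h3, abs_of_nonneg (div_nonneg (sub_nonneg.2 h1) hKpos.le)]
      refine le_trans ?_ hKε.le
      exact div_le_div_of_nonneg_right (by linarith) hKpos.le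
    rw [hfi]
    simpa only [dif_pos hz] using hval

/-! ### Concentration of certifiable functionals -/

/-- Two-set concentration for a functional of a bounded family with hypergraph dependence. -/
theorem SatisfiesHD.measureReal_mul_le {Ω : Type u} [MeasurableSpace Ω] {μ : Measure Ω}
    [IsProbabilityMeasure μ] {ι : Type v} [Fintype ι] {X : ι → Ω → ℝ} {k l : ℕ}
    (hHD : SatisfiesHD.{u, v, 0, w} μ X k l) (hk : 1 ≤ k) (hl : 1 ≤ l)
    (hb : ∀ i, ∀ᵐ ω ∂μ, |X i ω| ≤ 1) {φ : (ι → ℝ) → ℝ} {C D : ℝ} (hC : 0 < C)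
    (hφ : ∀ x : ι → ℝ, ∃ α : ι → ℝ, (∀ i, 0 ≤ α i) ∧ ∑ i, α i ^ 2 ≤ C ∧
      ∀ y : ι → ℝ, (∀ i, |x i| ≤ 1) → (∀ i, |y i| ≤ 1) →
        φ x - φ y ≤ ∑ i, α i * if x i ≠ y i then (1 : ℝ) else 0)
    (hφD : ∀ (x y : ι → ℝ) (δ : ℝ), 0 ≤ δ → (∀ i, |x i - y i| ≤ δ) → |φ x - φ y| ≤ D * δ)
    {a b : ℝ} (hab : a ≤ b) :
    μ.real {ω | φ (fun i => X i ω) ≤ a} * μ.real {ω | b ≤ φ (fun i => X i ω)} ≤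
      Real.exp (-((b - a) ^ 2 / (10 * (k * l * C)))) := by
  classical
  obtain ⟨N, E, mE, Y, S, f, hY, hind, hf, hX, hS, hR⟩ := hHD
  have main : ∀ ε : ℝ, 0 < ε →
      μ.real {ω | φ (fun i => X i ω) ≤ a} * μ.real {ω | b ≤ φ (fun i => X i ω)} ≤
        Real.exp (-((max (b - a - 2 * (D * ε)) 0) ^ 2 / (10 * (k * l * C)))) + 2 * ε + ε ^ 2 := by
    intro ε hε
    obtain ⟨T, _, _, _, π, h, Bad, hπ, hh, hBad, happ⟩ :=
      exists_finite_discretization hY hf hX hb hε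
    have hind' : iIndepFun (fun j => π j ∘ Y j) μ := hind.comp π hπ
    -- Both thresholds move by `D * ε`, so the gap shrinks by twice that; the maximum keeps `τ`
    -- nonnegative. The bound |x i| ≤ 1 is built into the sets because `hφ` certifies only such
    -- points.
    have htal := iIndepFun.talagrand_hypergraph (fun j => (hπ j).comp (hY j)) hind' hk hl S hS hR h
      {x | (∀ i, |x i| ≤ 1) ∧ φ x ≤ a + D * ε} {x | (∀ i, |x i| ≤ 1) ∧ b - D * ε ≤ φ x}
      (τ := max (b - a - 2 * (D * ε)) 0) (le_max_right _ _) hC (by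
        rintro x ⟨hx1, hx⟩
        obtain ⟨α, hα, hαC, hαx⟩ := hφ x
        refine ⟨α, hα, hαC, fun y ⟨hy1, hy⟩ => max_le ?_ ?_⟩
        · have := hαx y hx1 hy1
          linarith
        · refine Finset.sum_nonneg fun i _ => mul_nonneg (hα i) ?_
          split_ifs <;> norm_num)
    set PA := μ.real {ω | (fun i => h i fun j => (π j ∘ Y j) ω) ∈
      {x : ι → ℝ | (∀ i, |x i| ≤ 1) ∧ φ x ≤ a + D * ε}}
    set PB := μ.real {ω | (fun i => h i fun j => (π j ∘ Y j) ω) ∈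
      {x : ι → ℝ | (∀ i, |x i| ≤ 1) ∧ b - D * ε ≤ φ x}}
    have hA : μ.real {ω | φ (fun i => X i ω) ≤ a} ≤ PA + ε := by
      refine (measureReal_mono (fun ω hω => ?_)).trans
        ((measureReal_union_le _ Bad).trans (add_le_add le_rfl hBad))
      by_cases hωB : ω ∈ Bad
      · exact Or.inr hωB
      · refine Or.inl ⟨fun i => hh _ _, ?_⟩
        have := abs_le.1 (hφD _ _ ε hε.le (happ ω hωB))
        simp only [Set.mem_ofPred_eq, Function.comp_def] at hω ⊢
        linarith
    have hB : μ.real {ω | b ≤ φ (fun i => X i ω)} ≤ PB + ε := by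
      refine (measureReal_mono (fun ω hω => ?_)).trans
        ((measureReal_union_le _ Bad).trans (add_le_add le_rfl hBad))
      by_cases hωB : ω ∈ Bad
      · exact Or.inr hωB
      · refine Or.inl ⟨fun i => hh _ _, ?_⟩
        have := abs_le.1 (hφD _ _ ε hε.le (happ ω hωB))
        simp only [Set.mem_ofPred_eq, Function.comp_def] at hω ⊢
        linarith
    have hPA1 : PA ≤ 1 := measureReal_le_one
    have hPB1 : PB ≤ 1 := measureReal_le_one
    calc _ ≤ (PA + ε) * (PB + ε) :=
          mul_le_mul hA hB measureReal_nonneg (add_nonneg measureReal_nonneg hε.le)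
      _ ≤ PA * PB + 2 * ε + ε ^ 2 := by nlinarith
      _ ≤ _ := by gcongr
  have hlim : Filter.Tendsto (fun ε : ℝ =>
      Real.exp (-((max (b - a - 2 * (D * ε)) 0) ^ 2 / (10 * (k * l * C)))) + 2 * ε + ε ^ 2)
      (nhdsWithin 0 (Set.Ioi 0)) (nhds (Real.exp (-((b - a) ^ 2 / (10 * (k * l * C)))))) := by
    have hcont : Continuous fun ε : ℝ =>
        Real.exp (-((max (b - a - 2 * (D * ε)) 0) ^ 2 / (10 * (k * l * C)))) + 2 * ε + ε ^ 2 := by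
      fun_prop
    have := (hcont.tendsto 0).mono_left (nhdsWithin_le_nhds (s := Set.Ioi 0))
    simpa [max_eq_left (sub_nonneg.2 hab)] using this
  exact ge_of_tendsto hlim (eventually_nhdsWithin_of_forall main)

/-- Concentration around a median for a functional of a bounded family with hypergraph
dependence. -/
theorem SatisfiesHD.measureReal_median_deviation_le {Ω : Type u} [MeasurableSpace Ω]
    {μ : Measure Ω} [IsProbabilityMeasure μ] {ι : Type v} [Fintype ι] {X : ι → Ω → ℝ} {k l : ℕ}
    (hHD : SatisfiesHD.{u, v, 0, w} μ X k l) (hk : 1 ≤ k) (hl : 1 ≤ l)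
    (hb : ∀ i, ∀ᵐ ω ∂μ, |X i ω| ≤ 1) {φ : (ι → ℝ) → ℝ} {C D : ℝ} (hC : 0 < C)
    (hφ : ∀ x : ι → ℝ, ∃ α : ι → ℝ, (∀ i, 0 ≤ α i) ∧ ∑ i, α i ^ 2 ≤ C ∧
      ∀ y : ι → ℝ, (∀ i, |x i| ≤ 1) → (∀ i, |y i| ≤ 1) →
        φ x - φ y ≤ ∑ i, α i * if x i ≠ y i then (1 : ℝ) else 0)
    (hφD : ∀ (x y : ι → ℝ) (δ : ℝ), 0 ≤ δ → (∀ i, |x i - y i| ≤ δ) → |φ x - φ y| ≤ D * δ)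
    {m : ℝ} (hm : IsMedian μ (fun ω => φ fun i => X i ω) m) {t : ℝ} (ht : 0 ≤ t) :
    μ.real {ω | t < |φ (fun i => X i ω) - m|} ≤
      4 * Real.exp (-(t ^ 2 / (10 * (k * l * C)))) := by
  have hhalf : ∀ U : Set Ω, 1 / 2 ≤ μ U → 1 / 2 ≤ μ.real U := fun U hU => by
    have := ENNReal.toReal_mono (measure_ne_top μ U) hU
    simpa [measureReal_def] using this
  have h1 := hHD.measureReal_mul_le hk hl hb hC hφ hφD (show m ≤ m + t by linarith)
  have h2 := hHD.measureReal_mul_le hk hl hb hC hφ hφD (show m - t ≤ m by linarith)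
  rw [add_sub_cancel_left] at h1
  rw [sub_sub_cancel] at h2
  have hm1 := hhalf _ hm.1
  have hm2 := hhalf _ hm.2
  have hcover : μ.real {ω | t < |φ (fun i => X i ω) - m|} ≤
      μ.real {ω | φ (fun i => X i ω) ≤ m - t} + μ.real {ω | m + t ≤ φ (fun i => X i ω)} := by
    refine (measureReal_mono fun ω hω => ?_).trans (measureReal_union_le _ _)
    simp only [Set.mem_union, Set.mem_ofPred_eq] at hω ⊢
    rcases lt_abs.1 hω with h | h
    · right; linarith
    · left; linarith
  have hn1 : 0 ≤ μ.real {ω | φ (fun i => X i ω) ≤ m - t} := measureReal_nonneg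
  have hn2 : 0 ≤ μ.real {ω | m + t ≤ φ (fun i => X i ω)} := measureReal_nonneg
  -- In each product the half-line bounded by `m` has probability at least 1/2, so each tail is at
  -- most twice the exponential.
  nlinarith [mul_le_mul_of_nonneg_right hm1 hn2, mul_le_mul_of_nonneg_left hm2 hn1]

/-! ### Comparison of ordered eigenvalues -/

open Matrix in
/-- An orthonormal eigenbasis ordered by decreasing eigenvalues. -/
theorem exists_ordered_eigenbasis {n : ℕ} {A : Matrix (Fin n) (Fin n) ℝ} (hA : A.IsHermitian) :
    ∃ (b : OrthonormalBasis (Fin n) ℝ (EuclideanSpace ℝ (Fin n))) (lam : Fin n → ℝ),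
      Antitone lam ∧ (∀ i, A.toEuclideanLin (b i) = lam i • b i) ∧
      ∀ (s : ℕ) (hs : 1 ≤ s ∧ s ≤ n),
        sortedEigenvalue hA s hs = lam ⟨s - 1, by omega⟩ := by
  have hc : Fintype.card (Fin n) = n := Fintype.card_fin n
  refine ⟨((isSymmetric_toEuclideanLin_iff.mpr hA).eigenvectorBasis
    finrank_euclideanSpace).reindex (finCongr hc),
    fun i => hA.eigenvalues₀ (Fin.cast hc.symm i), ?_, ?_, ?_⟩
  · intro i j hij
    exact hA.eigenvalues₀_antitone (by simpa using hij)
  · intro i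
    rw [OrthonormalBasis.reindex_apply]
    exact (isSymmetric_toEuclideanLin_iff.mpr hA).apply_eigenvectorBasis finrank_euclideanSpace _
  · intro s hs
    rfl

/-- The quadratic form of a matrix in an orthonormal eigenbasis. -/
theorem inner_toEuclideanLin_eq_sum {n : ℕ} {A : Matrix (Fin n) (Fin n) ℝ}
    {b : OrthonormalBasis (Fin n) ℝ (EuclideanSpace ℝ (Fin n))} {lam : Fin n → ℝ}
    (hb : ∀ i, A.toEuclideanLin (b i) = lam i • b i) (u : EuclideanSpace ℝ (Fin n)) :
    inner ℝ u (A.toEuclideanLin u) = ∑ i, lam i * inner ℝ (b i) u ^ 2 := by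
  have h1 : A.toEuclideanLin u = ∑ i, inner ℝ (b i) u • (lam i • b i) := by
    conv_lhs => rw [← b.sum_repr' u, map_sum]
    simp [hb]
  rw [h1, inner_sum]
  refine Finset.sum_congr rfl fun i _ => ?_
  rw [inner_smul_right, inner_smul_right, real_inner_comm]
  ring

theorem inner_toEuclideanLin_eq_sum_sum {n : ℕ} (A : Matrix (Fin n) (Fin n) ℝ)
    (u : EuclideanSpace ℝ (Fin n)) :
    inner ℝ u (A.toEuclideanLin u) = ∑ i, ∑ j, u i * u j * A i j := by
  simp only [PiLp.inner_apply, Matrix.toLpLin_apply, Matrix.mulVec, dotProduct, RCLike.inner_apply,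
    conj_trivial, Finset.sum_mul]
  refine Finset.sum_congr rfl fun i _ => Finset.sum_congr rfl fun j _ => ?_
  ring

/-- A unit vector in the span of the first `s` vectors of one orthonormal basis that is orthogonal
to the first `s - 1` vectors of another one. -/
theorem exists_unit_vector_between {n : ℕ}
    (b b' : OrthonormalBasis (Fin n) ℝ (EuclideanSpace ℝ (Fin n))) (s : Fin n) :
    ∃ u : EuclideanSpace ℝ (Fin n), ‖u‖ = 1 ∧ (∀ i, s < i → inner ℝ (b i) u = 0) ∧
      ∀ i, i < s → inner ℝ (b' i) u = 0 := by
  -- Omitting the index `s` leaves n - 1 linear conditions on an n-dimensional space.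
  let L : EuclideanSpace ℝ (Fin n) →ₗ[ℝ] ({i : Fin n // i ≠ s} → ℝ) :=
    LinearMap.pi fun i => if s < i.1 then (innerSL ℝ (b i)).toLinearMap
      else (innerSL ℝ (b' i)).toLinearMap
  have hlt : Module.finrank ℝ ({i : Fin n // i ≠ s} → ℝ) <
      Module.finrank ℝ (EuclideanSpace ℝ (Fin n)) := by
    rw [Module.finrank_fintype_fun_eq_card, finrank_euclideanSpace]
    exact Fintype.card_subtype_lt (x := s) (by simp)
  obtain ⟨v, hv, hv0⟩ := (Submodule.ne_bot_iff _).1 (LinearMap.ker_ne_bot_of_finrank_lt hlt (f := L))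
  have hLv : ∀ i : {i : Fin n // i ≠ s}, L v i = 0 := fun i => by
    rw [LinearMap.mem_ker.1 hv]; rfl
  refine ⟨‖v‖⁻¹ • v, norm_smul_inv_norm hv0, fun i hi => ?_, fun i hi => ?_⟩
  · have := hLv ⟨i, hi.ne'⟩
    rw [inner_smul_right]
    simp only [L, LinearMap.pi_apply, if_pos hi] at this
    rw [show inner ℝ (b i) v = 0 from this, mul_zero]
  · have := hLv ⟨i, hi.ne⟩
    rw [inner_smul_right]
    simp only [L, LinearMap.pi_apply, if_neg hi.le.not_gt] at this
    rw [show inner ℝ (b' i) v = 0 from this, mul_zero]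

/-- Comparison of the ordered eigenvalues of two matrices on a single unit vector. -/
theorem exists_unit_vector_eigenvalue_sub_le {n : ℕ} {A A' : Matrix (Fin n) (Fin n) ℝ}
    {b b' : OrthonormalBasis (Fin n) ℝ (EuclideanSpace ℝ (Fin n))} {lam lam' : Fin n → ℝ}
    (hlam : Antitone lam) (hlam' : Antitone lam')
    (hb : ∀ i, A.toEuclideanLin (b i) = lam i • b i)
    (hb' : ∀ i, A'.toEuclideanLin (b' i) = lam' i • b' i) (s : Fin n) :
    ∃ u : EuclideanSpace ℝ (Fin n), ‖u‖ = 1 ∧ (∀ i, s < i → inner ℝ (b i) u = 0) ∧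
      lam s - lam' s ≤ ∑ i, ∑ j, u i * u j * (A i j - A' i j) := by
  obtain ⟨u, hu, h1, h2⟩ := exists_unit_vector_between b b' s
  refine ⟨u, hu, h1, ?_⟩
  have hsq : ∀ c : OrthonormalBasis (Fin n) ℝ (EuclideanSpace ℝ (Fin n)),
      ∑ i, inner ℝ (c i) u ^ 2 = 1 := fun c => by
    have := c.sum_sq_norm_inner_right u
    simpa [hu] using this
  have hge : lam s ≤ inner ℝ u (A.toEuclideanLin u) := by
    rw [inner_toEuclideanLin_eq_sum hb]
    calc lam s = ∑ i, lam s * inner ℝ (b i) u ^ 2 := by rw [← Finset.mul_sum, hsq, mul_one]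
      _ ≤ _ := Finset.sum_le_sum fun i _ => by
        rcases lt_or_ge s i with h | h
        · simp [h1 i h]
        · exact mul_le_mul_of_nonneg_right (hlam h) (sq_nonneg _)
  have hle : inner ℝ u (A'.toEuclideanLin u) ≤ lam' s := by
    rw [inner_toEuclideanLin_eq_sum hb']
    calc _ ≤ ∑ i, lam' s * inner ℝ (b' i) u ^ 2 := Finset.sum_le_sum fun i _ => by
          rcases lt_or_ge i s with h | h
          · simp [h2 i h]
          · exact mul_le_mul_of_nonneg_right (hlam' h) (sq_nonneg _)
      _ = lam' s := by rw [← Finset.mul_sum, hsq, mul_one]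
  rw [inner_toEuclideanLin_eq_sum_sum] at hge hle
  simp only [mul_sub, Finset.sum_sub_distrib]
  linarith

/-- Any ordered eigenbasis computes the sorted eigenvalues. -/
theorem sortedEigenvalue_eq_of_eigenbasis {n : ℕ} {A : Matrix (Fin n) (Fin n) ℝ}
    (hA : A.IsHermitian) {b : OrthonormalBasis (Fin n) ℝ (EuclideanSpace ℝ (Fin n))}
    {lam : Fin n → ℝ} (hlam : Antitone lam) (hb : ∀ i, A.toEuclideanLin (b i) = lam i • b i)
    (s : ℕ) (hs : 1 ≤ s ∧ s ≤ n) : sortedEigenvalue hA s hs = lam ⟨s - 1, by omega⟩ := by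
  obtain ⟨b', lam', hlam', hb', h⟩ := exists_ordered_eigenbasis hA
  rw [h s hs]
  -- Comparing the matrix with itself, in both orders, gives the two inequalities.
  obtain ⟨u, -, -, h1⟩ := exists_unit_vector_eigenvalue_sub_le hlam hlam' hb hb' ⟨s - 1, by omega⟩
  obtain ⟨u', -, -, h2⟩ := exists_unit_vector_eigenvalue_sub_le hlam' hlam hb' hb ⟨s - 1, by omega⟩
  simp only [sub_self, mul_zero, Finset.sum_const_zero] at h1 h2
  linarith

/-- Negation reverses the order of the eigenvalues. -/
theorem sortedEigenvalue_neg {n : ℕ} {A : Matrix (Fin n) (Fin n) ℝ} (hA : A.IsHermitian)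
    (hA' : (-A).IsHermitian) (s : ℕ) (hs : 1 ≤ s ∧ s ≤ n) (hs' : 1 ≤ n - s + 1 ∧ n - s + 1 ≤ n) :
    sortedEigenvalue hA' s hs = -sortedEigenvalue hA (n - s + 1) hs' := by
  obtain ⟨b, lam, hlam, hb, h⟩ := exists_ordered_eigenbasis hA
  rw [sortedEigenvalue_eq_of_eigenbasis hA' (b := b.reindex Fin.revPerm)
    (lam := fun i => -lam i.rev) ?_ ?_ s hs, h]
  -- Reversal sends the index s - 1 to n - s = (n - s + 1) - 1.
  · congr 2
    ext
    simp only [Fin.val_rev]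
    omega
  · intro i j hij
    exact neg_le_neg (hlam (Fin.rev_le_rev.2 hij))
  · intro i
    simp [hb]

/-- Weyl-type perturbation bound in terms of the entries. -/
theorem abs_sortedEigenvalue_sub_le {n : ℕ} {A A' : Matrix (Fin n) (Fin n) ℝ}
    (hA : A.IsHermitian) (hA' : A'.IsHermitian) (s : ℕ) (hs : 1 ≤ s ∧ s ≤ n) {δ : ℝ}
    (hδ : ∀ i j, |A i j - A' i j| ≤ δ) :
    |sortedEigenvalue hA s hs - sortedEigenvalue hA' s hs| ≤ (n : ℝ) ^ 2 * δ := by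
  have key : ∀ {A A' : Matrix (Fin n) (Fin n) ℝ} (hA : A.IsHermitian) (hA' : A'.IsHermitian),
      (∀ i j, |A i j - A' i j| ≤ δ) →
      sortedEigenvalue hA s hs - sortedEigenvalue hA' s hs ≤ (n : ℝ) ^ 2 * δ := by
    intro A A' hA hA' hδ
    obtain ⟨b, lam, hlam, hb, h⟩ := exists_ordered_eigenbasis hA
    obtain ⟨b', lam', hlam', hb', h'⟩ := exists_ordered_eigenbasis hA'
    obtain ⟨u, hu, -, h1⟩ := exists_unit_vector_eigenvalue_sub_le hlam hlam' hb hb' ⟨s - 1, by omega⟩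
    rw [h, h']
    refine h1.trans ?_
    -- A crude bound is enough: n² serves only as the constant `D`, which disappears when `ε` tends
    -- to 0.
    have hui : ∀ i, |u i| ≤ 1 := fun i => by
      have := PiLp.norm_apply_le u i
      rwa [hu, Real.norm_eq_abs] at this
    calc ∑ i, ∑ j, u i * u j * (A i j - A' i j) ≤ ∑ _i : Fin n, ∑ _j : Fin n, δ := by
          refine Finset.sum_le_sum fun i _ => Finset.sum_le_sum fun j _ => ?_
          refine (le_abs_self _).trans ?_
          rw [abs_mul, abs_mul]
          refine (mul_le_of_le_one_left (abs_nonneg _) ?_).trans (hδ i j)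
          exact mul_le_one₀ (hui i) (abs_nonneg _) (hui j)
      _ = (n : ℝ) ^ 2 * δ := by simp; ring
  refine abs_le.2 ⟨?_, key hA hA' hδ⟩
  have := key hA' hA fun i j => by rw [abs_sub_comm]; exact hδ i j
  linarith

/-! ### Weights certifying a change of eigenvalue -/

/-- A symmetric double sum as a weighted sum over the upper triangle. -/
theorem sum_sum_eq_sum_upper {n : ℕ} (g : Fin n → Fin n → ℝ) (hg : ∀ i j, g i j = g j i) :
    ∑ i, ∑ j, g i j = ∑ p : {p : Fin n × Fin n // p.1 ≤ p.2},
      (if p.1.1 = p.1.2 then 1 else 2) * g p.1.1 p.1.2 := by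
  have h1 : ∑ p : {p : Fin n × Fin n // p.1 ≤ p.2},
      (if p.1.1 = p.1.2 then 1 else 2) * g p.1.1 p.1.2 =
      ∑ i, ∑ j, if i ≤ j then (if i = j then 1 else 2) * g i j else 0 := by
    rw [← Fintype.sum_prod_type' (f := fun i j =>
      if i ≤ j then (if i = j then 1 else 2) * g i j else 0), ← Finset.sum_filter]
    exact (Finset.sum_subtype _ (by simp) (fun p : Fin n × Fin n =>
      (if p.1 = p.2 then 1 else 2) * g p.1 p.2)).symm
  have h2 : ∀ i j, (if i ≤ j then (if i = j then 1 else 2) * g i j else 0) =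
      (if i ≤ j then g i j else 0) + (if i < j then g i j else 0) := by
    intro i j
    rcases lt_trichotomy i j with h | h | h
    · simp [h, h.le, h.ne]; ring
    · simp [h]
    · simp [h.not_ge, h.not_gt]
  rw [h1]
  simp_rw [h2, Finset.sum_add_distrib]
  have h3 : ∑ i, ∑ j, (if i < j then g i j else 0) = ∑ i, ∑ j, (if j < i then g i j else 0) := by
    rw [Finset.sum_comm]
    refine Finset.sum_congr rfl fun i _ => Finset.sum_congr rfl fun j _ => ?_
    rw [hg]
  rw [h3, ← Finset.sum_add_distrib]
  refine Finset.sum_congr rfl fun i _ => ?_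
  rw [← Finset.sum_add_distrib]
  refine Finset.sum_congr rfl fun j _ => ?_
  rcases le_or_gt i j with h | h
  · simp [h, h.not_gt]
  · simp [h, h.not_ge]

/-- The change of the `s`-th eigenvalue is certified by weights on the upper triangle that depend
on one of the two matrices only. -/
theorem exists_weights_sortedEigenvalue_sub_le {n : ℕ} {A : Matrix (Fin n) (Fin n) ℝ}
    (hA : A.IsHermitian) (s : ℕ) (hs : 1 ≤ s ∧ s ≤ n) :
    ∃ α : {p : Fin n × Fin n // p.1 ≤ p.2} → ℝ, (∀ p, 0 ≤ α p) ∧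
      ∑ p, α p ^ 2 ≤ 8 * (s : ℝ) ^ 2 ∧
      ∀ (A' : Matrix (Fin n) (Fin n) ℝ) (hA' : A'.IsHermitian), (∀ i j, |A i j| ≤ 1) →
        (∀ i j, |A' i j| ≤ 1) → sortedEigenvalue hA s hs - sortedEigenvalue hA' s hs ≤
          ∑ p, α p * if A p.1.1 p.1.2 ≠ A' p.1.1 p.1.2 then (1 : ℝ) else 0 := by
  obtain ⟨b, lam, hlam, hb, h⟩ := exists_ordered_eigenbasis hA
  set s' : Fin n := ⟨s - 1, by omega⟩ with hs'
  -- The diagonal of the projection onto the first `s` eigenvectors of `A`; its trace is `s`.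
  set W : Fin n → ℝ := fun q => ∑ i ∈ Finset.Iic s', b i q ^ 2 with hW
  have hW0 : ∀ q, 0 ≤ W q := fun q => Finset.sum_nonneg fun i _ => sq_nonneg _
  have hWs : ∑ q, W q = s := by
    rw [hW, Finset.sum_comm]
    have : ∀ i, ∑ q, b i q ^ 2 = 1 := fun i => by
      have := EuclideanSpace.real_norm_sq_eq (b i)
      rw [← this, b.norm_eq_one, one_pow]
    simp only [this, Finset.sum_const, nsmul_eq_mul, mul_one, Fin.card_Iic, hs']
    norm_cast
    omega
  -- The inner 2 bounds |A i j - A' i j|; the factor 2 off the diagonal counts both symmetric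
  -- entries.
  refine ⟨fun p => (if p.1.1 = p.1.2 then 1 else 2) *
    (2 * (Real.sqrt (W p.1.1) * Real.sqrt (W p.1.2))), fun p => ?_, ?_, fun A' hA' h1 h1' => ?_⟩
  · dsimp only
    split_ifs <;> positivity
  -- The squared weight is 16 W_i W_j = 2 · 8 W_i W_j off the diagonal and 4 W_i W_i ≤ 8 W_i W_i on
  -- it.
  · calc _ ≤ ∑ p : {p : Fin n × Fin n // p.1 ≤ p.2},
          (if p.1.1 = p.1.2 then 1 else 2) * (8 * (W p.1.1 * W p.1.2)) := by
          refine Finset.sum_le_sum fun p _ => ?_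
          have hnn := mul_nonneg (hW0 p.1.1) (hW0 p.1.2)
          rw [mul_pow, mul_pow, mul_pow, Real.sq_sqrt (hW0 _), Real.sq_sqrt (hW0 _)]
          split_ifs <;> nlinarith
      _ = ∑ i, ∑ j, 8 * (W i * W j) :=
          (sum_sum_eq_sum_upper (fun i j => 8 * (W i * W j)) fun i j => by ring).symm
      _ = 8 * (∑ i, W i) ^ 2 := by
          rw [sq, Finset.sum_mul_sum, Finset.mul_sum]
          simp_rw [Finset.mul_sum]
      _ ≤ 8 * (s : ℝ) ^ 2 := by rw [hWs]
  · obtain ⟨b', lam', hlam', hb', h'⟩ := exists_ordered_eigenbasis hA'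
    obtain ⟨u, hu, hu0, hle⟩ := exists_unit_vector_eigenvalue_sub_le hlam hlam' hb hb' s'
    rw [h, h']
    refine hle.trans ?_
    have huW : ∀ q, |u q| ≤ Real.sqrt (W q) := by
      intro q
      refine Real.abs_le_sqrt ?_
      have hexp : u q = ∑ i ∈ Finset.Iic s', inner ℝ (b i) u * b i q := by
        have h2 := congrArg (fun v : EuclideanSpace ℝ (Fin n) => v q) (b.sum_repr' u)
        simp only [WithLp.ofLp_sum, Finset.sum_apply, PiLp.smul_apply, smul_eq_mul] at h2
        rw [← h2]
        refine (Finset.sum_subset (Finset.subset_univ _) fun i _ hi => ?_).symm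
        rw [hu0 i (by simpa using hi), zero_mul]
      have hsum : ∑ i ∈ Finset.Iic s', inner ℝ (b i) u ^ 2 ≤ 1 := by
        have h3 : ∑ i, inner ℝ (b i) u ^ 2 = 1 := by
          have := b.sum_sq_norm_inner_right u
          simpa [hu] using this
        rw [← h3]
        exact Finset.sum_le_sum_of_subset_of_nonneg (Finset.subset_univ _)
          fun i _ _ => sq_nonneg _
      rw [hexp]
      exact (Finset.sum_mul_sq_le_sq_mul_sq _ _ _).trans
        (mul_le_of_le_one_left (hW0 q) hsum)
    have hsymA : ∀ i j, A i j = A j i := fun i j => by simpa using hA.apply j i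
    have hsymA' : ∀ i j, A' i j = A' j i := fun i j => by simpa using hA'.apply j i
    calc ∑ i, ∑ j, u i * u j * (A i j - A' i j)
        ≤ ∑ i, ∑ j, 2 * (Real.sqrt (W i) * Real.sqrt (W j)) *
            (if A i j ≠ A' i j then (1 : ℝ) else 0) := by
          refine Finset.sum_le_sum fun i _ => Finset.sum_le_sum fun j _ => ?_
          split_ifs with hne
          · have hd : |A i j - A' i j| ≤ 2 := by
              have := abs_sub (A i j) (A' i j)
              linarith [h1 i j, h1' i j]
            refine (le_abs_self _).trans ?_
            rw [abs_mul, abs_mul, mul_one, mul_comm 2]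
            exact mul_le_mul (mul_le_mul (huW i) (huW j) (abs_nonneg _) (Real.sqrt_nonneg _)) hd
              (abs_nonneg _) (by positivity)
          · rw [ne_eq, not_not] at hne
            simp [hne]
      _ = _ := by
          rw [sum_sum_eq_sum_upper]
          · refine Finset.sum_congr rfl fun p _ => ?_
            ring
          · intro i j
            rw [hsymA i j, hsymA' i j, mul_comm (Real.sqrt (W i))]

/-! ### Concentration for random symmetric matrices -/

/-- The symmetric matrix with prescribed entries on and above the diagonal. -/
def symmetricOfUpper {n : ℕ} (x : {p : Fin n × Fin n // p.1 ≤ p.2} → ℝ) :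
    Matrix (Fin n) (Fin n) ℝ :=
  fun i j => x ⟨(min i j, max i j), min_le_max⟩

theorem symmetricOfUpper_isHermitian {n : ℕ} (x : {p : Fin n × Fin n // p.1 ≤ p.2} → ℝ) :
    (symmetricOfUpper x).IsHermitian := by
  ext i j
  simp [symmetricOfUpper, min_comm, max_comm]

theorem symmetricOfUpper_apply_upper {n : ℕ} (x : {p : Fin n × Fin n // p.1 ≤ p.2} → ℝ)
    (p : {p : Fin n × Fin n // p.1 ≤ p.2}) : symmetricOfUpper x p.1.1 p.1.2 = x p := by
  simp [symmetricOfUpper, min_eq_left p.2, max_eq_right p.2]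

theorem Matrix.IsHermitian.symmetricOfUpper_eq {n : ℕ} {A : Matrix (Fin n) (Fin n) ℝ}
    (hA : A.IsHermitian) : symmetricOfUpper (fun p => A p.1.1 p.1.2) = A := by
  ext i j
  rcases le_total i j with h | h
  · simp [symmetricOfUpper, h]
  · simpa [symmetricOfUpper, h] using hA.apply i j

/-- The proof of symmetry depends on the matrix, so equal matrices are exchanged together with their
proofs. -/
theorem sortedEigenvalue_congr {n : ℕ} {A B : Matrix (Fin n) (Fin n) ℝ} (hAB : A = B)
    (hA : A.IsHermitian) (hB : B.IsHermitian) (s : ℕ) (hs : 1 ≤ s ∧ s ≤ n) :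
    sortedEigenvalue hA s hs = sortedEigenvalue hB s hs := by
  subst hAB
  rfl

/-- Concentration of the `s`-th largest eigenvalue around a median. -/
theorem sortedEigenvalue_concentration {Ω : Type u} [MeasurableSpace Ω] (μ : Measure Ω)
    [IsProbabilityMeasure μ] (n : ℕ) (M : Ω → Matrix (Fin n) (Fin n) ℝ)
    (hsymm : ∀ ω, (M ω).IsHermitian)
    (hbdd : ∀ i j, ∀ᵐ ω ∂μ, |M ω i j| ≤ 1)
    (k l : ℕ) (hk : 1 ≤ k) (hl : 1 ≤ l)
    (hHD : SatisfiesHD.{u, 0, 0, w} μ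
      (fun (p : {p : Fin n × Fin n // p.1 ≤ p.2}) (ω : Ω) => M ω p.1.1 p.1.2) k l)
    (s : ℕ) (hs : 1 ≤ s ∧ s ≤ n) (m : ℝ)
    (hm : IsMedian μ (fun ω => sortedEigenvalue (hsymm ω) s hs) m) (t : ℝ) (ht : 0 ≤ t) :
    μ.real {ω | t < |sortedEigenvalue (hsymm ω) s hs - m|} ≤
      4 * Real.exp (-(t ^ 2 / (80 * (s : ℝ) ^ 2 * (k * l)))) := by
  have hs0 : (0 : ℝ) < s := by exact_mod_cast hs.1
  have hφ : ∀ ω, sortedEigenvalue (hsymm ω) s hs = sortedEigenvalue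
      (symmetricOfUpper_isHermitian fun p => M ω p.1.1 p.1.2) s hs := fun ω =>
    sortedEigenvalue_congr (hsymm ω).symmetricOfUpper_eq.symm _ _ s hs
  simp only [hφ] at hm ⊢
  -- Here `C = 8 * s ^ 2`, so that `10 * C` produces the constant 80.
  have := hHD.measureReal_median_deviation_le hk hl (fun p => hbdd _ _)
    (φ := fun x => sortedEigenvalue (symmetricOfUpper_isHermitian x) s hs)
    (C := 8 * (s : ℝ) ^ 2) (D := (n : ℝ) ^ 2) (by positivity)
    (fun x => by
      obtain ⟨α, h0, hC, h⟩ :=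
        exists_weights_sortedEigenvalue_sub_le (symmetricOfUpper_isHermitian x) s hs
      refine ⟨α, h0, hC, fun y hx hy => ?_⟩
      have := h _ (symmetricOfUpper_isHermitian y) (fun i j => hx _) (fun i j => hy _)
      simpa only [symmetricOfUpper_apply_upper] using this)
    (fun x y δ _ hxy => abs_sortedEigenvalue_sub_le _ _ s hs fun i j => hxy _) hm ht
  convert this using 5
  ring

/-- Hypergraph dependence is preserved by negation. -/
theorem SatisfiesHD.neg {Ω : Type u} [MeasurableSpace Ω] {μ : Measure Ω} {ι : Type v} [Fintype ι]
    {X : ι → Ω → ℝ} {k l : ℕ} (h : SatisfiesHD.{u, v, 0, w} μ X k l) :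
    SatisfiesHD.{u, v, 0, w} μ (fun i ω => -X i ω) k l := by
  obtain ⟨N, E, mE, Y, S, f, hY, hind, hf, hX, hS, hR⟩ := h
  refine ⟨N, E, mE, Y, S, fun i y => -f i y, hY, hind, fun i => (hf i).neg, fun i => ?_, hS, hR⟩
  filter_upwards [hX i] with ω hω
  rw [hω]

theorem IsMedian.neg {Ω : Type*} [MeasurableSpace Ω] {μ : Measure Ω} {Z : Ω → ℝ} {m : ℝ}
    (h : IsMedian μ Z m) : IsMedian μ (fun ω => -Z ω) (-m) := by
  refine ⟨?_, ?_⟩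
  · simpa using h.2
  · simpa using h.1

theorem mainTheorem6 {Ω : Type u} [MeasurableSpace Ω] (μ : Measure Ω)
    [IsProbabilityMeasure μ] (n : ℕ) (M : Ω → Matrix (Fin n) (Fin n) ℝ)
    (hsymm : ∀ ω, (M ω).IsHermitian)
    (hbdd : ∀ i j, ∀ᵐ ω ∂μ, |M ω i j| ≤ 1)
    (k l : ℕ) (hk : 1 ≤ k) (hl : 1 ≤ l)
    (hHD : SatisfiesHD.{u, 0, 0, w} μ
      (fun (p : {p : Fin n × Fin n // p.1 ≤ p.2}) (ω : Ω) => M ω p.1.1 p.1.2) k l)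
    (s : ℕ) (hs : 1 ≤ s) (hsn : s ≤ n) :
    (∀ m : ℝ, IsMedian μ (fun ω => sortedEigenvalue (hsymm ω) s ⟨hs, hsn⟩) m →
      ∀ t : ℝ, 0 ≤ t →
        μ.real {ω | t < |sortedEigenvalue (hsymm ω) s ⟨hs, hsn⟩ - m|} ≤
          4 * Real.exp (-(t ^ 2 / (80 * (s : ℝ) ^ 2 * (k * l))))) ∧
    (∀ m : ℝ, IsMedian μ
        (fun ω => sortedEigenvalue (hsymm ω) (n - s + 1) ⟨by omega, by omega⟩) m →
      ∀ t : ℝ, 0 ≤ t →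
        μ.real {ω | t < |sortedEigenvalue (hsymm ω) (n - s + 1) ⟨by omega, by omega⟩ - m|} ≤
          4 * Real.exp (-(t ^ 2 / (80 * (s : ℝ) ^ 2 * (k * l))))) := by
  refine ⟨sortedEigenvalue_concentration μ n M hsymm hbdd k l hk hl hHD s ⟨hs, hsn⟩,
    fun m hm t ht => ?_⟩
  -- Viewed as the `s`-th eigenvalue of `-M`, the lower eigenvalue gets the factor s² instead of (n
  -- - s + 1)².
  have heq : ∀ ω, sortedEigenvalue (hsymm ω).neg s ⟨hs, hsn⟩ =
      -sortedEigenvalue (hsymm ω) (n - s + 1) ⟨by omega, by omega⟩ := fun ω =>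
    sortedEigenvalue_neg (hsymm ω) _ s ⟨hs, hsn⟩ _
  have := sortedEigenvalue_concentration μ n (fun ω => -M ω) (fun ω => (hsymm ω).neg)
    (fun i j => by simpa using hbdd i j) k l hk hl hHD.neg s ⟨hs, hsn⟩ (-m)
    (by simpa only [heq] using hm.neg) t ht
  refine le_trans (le_of_eq ?_) this
  congr 1
  ext ω
  simp only [heq, Set.mem_ofPred_eq]
  rw [neg_sub_neg, abs_sub_comm]
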